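/- Let $(X,d)$ be a doubling metric space: there is an integer $N\ge 2$ such that every closed ball $B(x,r)=\{y\in X: d(x,y)\le r\}$, $r>0$, can be covered by $N$ closed balls of radius $r/2$. Let $\mu$ be a Radon measure on $X$, meaning a nontrivial Borel regular (outer) measure on $X$ for which bounded sets have finite measure, and let $\operatorname{spt}(\mu)$ be its support. For $x\in\operatorname{spt}(\mu)$ put $$\underline{\dim}_{\mathrm{loc}}(\mu,x)=\liminf_{r\downarrow0}\frac{\log\mu(B(x,r))}{\log r},\qquad \overline{\dim}_{\mathrm{loc}}(\mu,x)=\limsup_{r\downarrow0}\frac{\log\mu(B(x,r))}{\log r}.$$ A $\delta$-packing of a set $A\subset X$ is a countable family of pairwise disjoint closed balls of radius $\delta$ with centres in $A$. For $x\in\operatorname{spt}(\mu)$, $q\in\mathbb{R}$ and $\delta,r>0$ let $$S^*_{q,\delta,r}(\mu,x)=\sup\Bigl\{\sum_{B\in\mathcal B}\mu(B)^q : \mathcal B\text{ is a }\delta\text{-packing of }B(x,r)\cap\operatorname{spt}(\mu)\Bigr\},$$ $$\tau_q(\mu,x)=\lim_{r\downarrow0}\liminf_{\delta\downarrow0}\frac{\log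 S^*_{q,\delta,r}(\mu,x)}{\log\delta},\qquad \dim_q(\mu,x)=\frac{\tau_q(\mu,x)}{q-1}\quad(q\ne1),$$ where the limit in $r$ exists by monotonicity, and let $$\overline{\dim}_1(\mu,x)=\limsup_{r\downarrow0}\limsup_{\delta\downarrow0}\frac{1}{\log\delta}\,\frac{1}{\mu(B(x,r))}\int_{B(x,r)}\log\mu(B(y,\delta))\,d\mu(y),$$ $$\underline{\dim}_1(\mu,x)=\liminf_{r\downarrow0}\liminf_{\delta\downarrow0}\frac{1}{\log\delta}\,\frac{1}{\mu(B(x,r))}\int_{B(x,r)}\log\mu(B(y,\delta))\,d\mu(y).$$ Then, for $\mu$-almost every $x\in X$, the one-sided limits of $q\mapsto\dim_q(\mu,x)$ at $q=1$ exist and $$\lim_{q\downarrow1}\dim_q(\mu,x)\le\underline{\dim}_{\mathrm{loc}}(\mu,x)\le\overline{\dim}_{\mathrm{loc}}(\mu,x)\le\lim_{q\uparrow1}\dim_q(\mu,x).$$ If, in addition, $\mu$ has the density point property, that is, for every $\mu$-measurable $A\subset X$ one has $\lim_{r\downarrow0}\mu(A\cap B(x,r))/\mu(B(x,r))=1$ for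 $\mu$-almost every $x\in A$, then $$\underline{\dim}_{\mathrm{loc}}(\mu,x)\le\underline{\dim}_1(\mu,x)\le\overline{\dim}_1(\mu,x)\le\overline{\dim}_{\mathrm{loc}}(\mu,x)$$ for $\mu$-almost every $x\in X$. -/

import Mathlib

open Filter Topology MeasureTheory Metric

noncomputable section

namespace LocalDim

/-- A metric space is doubling if there is `N ≥ 2` such that every closed ball of radius `r > 0`
is covered by (at most) `N` closed balls of radius `r / 2`. -/
def IsDoublingSpace (X : Type*) [MetricSpace X] : Prop :=
  ∃ N : ℕ, 2 ≤ N ∧ ∀ (x : X) (r : ℝ), 0 < r →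
    ∃ t : Finset X, t.card ≤ N ∧ closedBall x r ⊆ ⋃ y ∈ t, closedBall y (r / 2)

/-- Nontrivial measures that are finite on bounded sets. A Mathlib measure on the Borel
sigma-algebra, evaluated on arbitrary sets, is the same thing as a Borel regular outer measure. -/
structure IsRadonMeasure {X : Type*} [MetricSpace X] [MeasurableSpace X] [BorelSpace X]
    (μ : Measure X) : Prop where
  nontrivial : μ ≠ 0
  finite_of_isBounded : ∀ s : Set X, Bornology.IsBounded s → μ s < ⊤

/-- `C` is the set of centres of a `δ`-packing of `A`: a countable family of pairwise disjoint
closed balls of radius `δ` whose centres lie in `A`. -/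
structure IsPacking {X : Type*} [MetricSpace X] (δ : ℝ) (A C : Set X) : Prop where
  countable : C.Countable
  subset : C ⊆ A
  pairwiseDisjoint : C.PairwiseDisjoint (fun c => closedBall c δ)

section Measures

variable {X : Type*} [MetricSpace X] [MeasurableSpace X]

/-- The upper local dimension of `μ` at `x`. -/
def upperLocalDim (μ : Measure X) (x : X) : EReal :=
  limsup (fun r : ℝ => ENNReal.log (μ (closedBall x r)) / (Real.log r : EReal)) (𝓝[>] 0)

/-- The lower local dimension of `μ` at `x`. -/
def lowerLocalDim (μ : Measure X) (x : X) : EReal :=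
  liminf (fun r : ℝ => ENNReal.log (μ (closedBall x r)) / (Real.log r : EReal)) (𝓝[>] 0)

/-- The supremum of `∑ μ(B) ^ q` over all `δ`-packings of `B(x, r) ∩ spt μ`. -/
def packingSum (μ : Measure X) (q δ r : ℝ) (x : X) : ENNReal :=
  ⨆ (C : Set X) (_ : IsPacking δ (closedBall x r ∩ μ.support) C),
    ∑' c : C, μ (closedBall (c : X) δ) ^ q

/-- The lower limit, as `δ ↓ 0`, of `log S / log δ`, where `S` is the packing sum at scale `r`. -/
def lqSpectrumAtScale (μ : Measure X) (q : ℝ) (x : X) (r : ℝ) : EReal :=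
  liminf (fun δ : ℝ => ENNReal.log (packingSum μ q δ r x) / (Real.log δ : EReal)) (𝓝[>] 0)

/-- The local `L^q`-spectrum of `μ` at `x`. The limit as `r ↓ 0` always exists,
see `tendsto_localLqSpectrum`. -/
def localLqSpectrum (μ : Measure X) (q : ℝ) (x : X) : EReal :=
  limUnder (𝓝[>] (0 : ℝ)) (lqSpectrumAtScale μ q x)

/-- The local `L^q`-dimension of `μ` at `x`, for `q ≠ 1`. -/
def localLqDim (μ : Measure X) (q : ℝ) (x : X) : EReal :=
  localLqSpectrum μ q x / ((q - 1 : ℝ) : EReal)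

/-- The mean over `B(x, r)` of `log μ(B(y, δ))`, divided by `log δ`. The mean is that of an
integrable function for Radon measures on doubling spaces, see `integrableOn_log_measure`. -/
def entropyQuotient (μ : Measure X) (x : X) (r δ : ℝ) : ℝ :=
  (⨍ y in closedBall x r, Real.log (μ.real (closedBall y δ)) ∂μ) / Real.log δ

/-- The upper (local) entropy dimension of `μ` at `x`. -/
def upperEntropyDim (μ : Measure X) (x : X) : EReal :=
  limsup (fun r : ℝ => limsup (fun δ : ℝ => (entropyQuotient μ x r δ : EReal)) (𝓝[>] 0)) (𝓝[>] 0)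

/-- The lower (local) entropy dimension of `μ` at `x`. -/
def lowerEntropyDim (μ : Measure X) (x : X) : EReal :=
  liminf (fun r : ℝ => liminf (fun δ : ℝ => (entropyQuotient μ x r δ : EReal)) (𝓝[>] 0)) (𝓝[>] 0)

/-- The density point property: for every `μ`-measurable `A`, almost every point of `A` is a
density point of `A`. -/
def HasDensityPointProperty (μ : Measure X) : Prop :=
  ∀ A : Set X, NullMeasurableSet A μ → ∀ᵐ x ∂μ, x ∈ A →
    Tendsto (fun r : ℝ => μ (A ∩ closedBall x r) / μ (closedBall x r)) (𝓝[>] 0) (𝓝 1)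

theorem packingSum_mono (μ : Measure X) (q δ : ℝ) (x : X) {r s : ℝ} (h : r ≤ s) :
    packingSum μ q δ r x ≤ packingSum μ q δ s x := by
  refine iSup₂_le fun C hC => ?_
  exact le_iSup₂_of_le C ⟨hC.countable,
    hC.subset.trans (Set.inter_subset_inter_left _ (closedBall_subset_closedBall h)),
    hC.pairwiseDisjoint⟩ le_rfl

theorem lqSpectrumAtScale_antitone (μ : Measure X) (q : ℝ) (x : X) :
    Antitone (lqSpectrumAtScale μ q x) := by
  intro r s h
  refine liminf_le_liminf ?_
  have h1 : ∀ᶠ δ : ℝ in 𝓝[>] 0, δ < 1 :=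
    eventually_nhdsWithin_of_eventually_nhds (eventually_lt_nhds one_pos)
  filter_upwards [h1, self_mem_nhdsWithin] with δ h1 h0
  have hneg : Real.log δ < 0 := Real.log_neg h0 h1
  exact EReal.antitone_div_right_of_nonpos (by exact_mod_cast hneg.le)
    (ENNReal.log_monotone (packingSum_mono μ q δ x h))

/-- The limit in the definition of the local `L^q`-spectrum exists. -/
theorem tendsto_localLqSpectrum (μ : Measure X) (q : ℝ) (x : X) :
    Tendsto (lqSpectrumAtScale μ q x) (𝓝[>] 0) (𝓝 (localLqSpectrum μ q x)) :=
  tendsto_nhds_limUnder ⟨_, (lqSpectrumAtScale_antitone μ q x).tendsto_nhdsGT 0⟩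

end Measures

theorem IsDoublingSpace.exists_finset_cover {X : Type*} [MetricSpace X] (hX : IsDoublingSpace X)
    (x : X) (r : ℝ) {ε : ℝ} (hε : 0 < ε) :
    ∃ t : Finset X, closedBall x r ⊆ ⋃ y ∈ t, closedBall y ε := by
  classical
  obtain ⟨N, -, hN⟩ := hX
  have key : ∀ (k : ℕ) (x : X) (r : ℝ), r ≤ 2 ^ k * ε →
      ∃ t : Finset X, closedBall x r ⊆ ⋃ y ∈ t, closedBall y ε := by
    intro k
    induction k with
    | zero =>
      intro x r h
      exact ⟨{x}, by simpa using closedBall_subset_closedBall (by simpa using h)⟩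
    | succ k ih =>
      intro x r h
      obtain ⟨t, -, ht⟩ := hN x (2 ^ (k + 1) * ε) (by positivity)
      choose f hf using fun y => ih y (2 ^ (k + 1) * ε / 2) (by rw [pow_succ]; linarith)
      refine ⟨t.biUnion f, (closedBall_subset_closedBall h).trans (ht.trans ?_)⟩
      refine Set.iUnion₂_subset fun y hy => (hf y).trans ?_
      refine Set.iUnion₂_subset fun z hz => ?_
      exact Set.subset_biUnion_of_mem (u := fun z => closedBall z ε)
        (Finset.mem_biUnion.2 ⟨y, hy, hz⟩)
  obtain ⟨k, hk⟩ := pow_unbounded_of_one_lt (r / ε) one_lt_two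
  exact key k x r (by rw [div_lt_iff₀ hε] at hk; exact hk.le)

theorem IsDoublingSpace.secondCountable {X : Type*} [MetricSpace X] (hX : IsDoublingSpace X) :
    SecondCountableTopology X := by
  refine Metric.secondCountable_of_almost_dense_set fun ε hε => ?_
  rcases isEmpty_or_nonempty X with h | ⟨⟨x⟩⟩
  · exact ⟨∅, by simp, fun x => (h.false x).elim⟩
  choose t ht using fun n : ℕ => hX.exists_finset_cover x n hε
  refine ⟨⋃ n, (t n : Set X), Set.countable_iUnion fun n => (t n).countable_toSet, fun y => ?_⟩
  obtain ⟨n, hn⟩ := exists_nat_ge (dist y x)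
  have := ht n (mem_closedBall.2 hn)
  simp only [Set.mem_iUnion, mem_closedBall] at this
  obtain ⟨z, hz, hz'⟩ := this
  exact ⟨z, Set.mem_iUnion.2 ⟨n, hz⟩, hz'⟩

/-- The integrand in the definition of the entropy dimensions is integrable. -/
theorem integrableOn_log_measure {X : Type*} [MetricSpace X] [MeasurableSpace X] [BorelSpace X]
    (hX : IsDoublingSpace X) {μ : Measure X} (hμ : IsRadonMeasure μ) (x : X) (r : ℝ) {δ : ℝ}
    (hδ : 0 < δ) :
    IntegrableOn (fun y => Real.log (μ.real (closedBall y δ))) (closedBall x r) μ := by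
  classical
  have := hX.secondCountable
  have hfin : ∀ (y : X) (s : ℝ), μ (closedBall y s) ≠ ⊤ := fun y s =>
    (hμ.finite_of_isBounded _ isBounded_closedBall).ne
  have : IsLocallyFiniteMeasure μ := ⟨fun y =>
    ⟨closedBall y 1, closedBall_mem_nhds y one_pos, (hfin y 1).lt_top⟩⟩
  have hmeas : Measurable fun y : X => Real.log (μ.real (closedBall y δ)) := by
    refine Real.measurable_log.comp (Measurable.ennreal_toReal ?_)
    have hs : MeasurableSet {p : X × X | dist p.2 p.1 ≤ δ} :=
      (isClosed_le (continuous_snd.dist continuous_fst) continuous_const).measurableSet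
    exact measurable_measure_prodMk_left hs
  obtain ⟨t, ht⟩ := hX.exists_finset_cover x r (half_pos hδ)
  set g : X → ℝ := fun c => |Real.log (μ.real (closedBall c (δ / 2)))|
  refine Measure.integrableOn_of_bounded (hfin x r) hmeas.aestronglyMeasurable
    (M := |Real.log (μ.real (closedBall x (r + δ)))| + ∑ c ∈ t, g c) ?_
  rw [ae_restrict_iff' measurableSet_closedBall]
  have hnull : ∀ᵐ y ∂μ, ∀ c ∈ t, μ (closedBall c (δ / 2)) = 0 → y ∉ closedBall c (δ / 2) := by
    refine (Filter.eventually_all_finset t).2 fun c _ => ?_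
    by_cases h : μ (closedBall c (δ / 2)) = 0
    · filter_upwards [measure_eq_zero_iff_ae_notMem.1 h] with y hy _ using hy
    · exact Eventually.of_forall fun y h' => (h h').elim
  filter_upwards [hnull] with y hy hyx
  have := ht hyx
  simp only [Set.mem_iUnion] at this
  obtain ⟨c, hc, hyc⟩ := this
  have hpos : 0 < μ.real (closedBall c (δ / 2)) :=
    ENNReal.toReal_pos (fun h => hy c hc h hyc) (hfin _ _)
  have h1 : μ.real (closedBall c (δ / 2)) ≤ μ.real (closedBall y δ) := by
    refine measureReal_mono (closedBall_subset_closedBall' ?_) (hfin _ _)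
    have := mem_closedBall'.1 hyc
    linarith
  have h2 : μ.real (closedBall y δ) ≤ μ.real (closedBall x (r + δ)) := by
    refine measureReal_mono (closedBall_subset_closedBall' ?_) (hfin _ _)
    have := mem_closedBall.1 hyx
    linarith
  have l1 := Real.log_le_log hpos h1
  have l2 := Real.log_le_log (hpos.trans_le h1) h2
  have h3 : g c ≤ ∑ c ∈ t, g c := Finset.single_le_sum (fun _ _ => abs_nonneg _) hc
  have h4 : (0 : ℝ) ≤ g c := abs_nonneg _
  have h5 := neg_abs_le (Real.log (μ.real (closedBall c (δ / 2))))
  have h6 := le_abs_self (Real.log (μ.real (closedBall x (r + δ))))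
  have h7 := abs_nonneg (Real.log (μ.real (closedBall x (r + δ))))
  rw [Real.norm_eq_abs, abs_le]
  constructor <;> (simp only [g] at *; linarith)

end LocalDim

end

/-!
Write `m(y, δ)` for `μ(B(y, δ))`.

**`L^q`-dimensions.** Hölder's inequality between the exponents `1` and `p` bounds the packing sum
at an exponent `q` between `1` and `p` by a power of the one at `p`, up to the measure of a fixed
ball. Hence `q ↦ dim_q(μ, x)` is antitone on each side of `1` and has one-sided limits at `1`
(`localLqDim_antitoneOn_Ioi`, `localLqDim_antitoneOn_Iio`).

To compare with the local dimensions, fix `q ≠ 1` and a rate `s`. Selecting balls of radius `δ`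
greedily by their *measure*, with Vitali's covering argument, yields from any bounded set `A` a
`δ`-packing that carries a fixed part of `μ(A)`, because each discarded ball meets a selected one of
comparable or larger measure and the space is doubling (`exists_isPacking_measure_le`). Applied to
the set of `y ∈ B(x, r)` where `m(y, δ)` is on the wrong side of `δ^s`, this bounds the measure of
that set by `δ^{s (1 - q)}` times the packing sum, which is a positive power of `δ` as soon as
`τ_q(μ, x) > s (q - 1)`. Borel–Cantelli along `δ = 2⁻ⁿ` then shows that almost every `y ∈ B(x, r)`
has lower local dimension at least `s` (if `q > 1`), or upper local dimension at most `s`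
(if `q < 1`). As `x` has such a neighbourhood whenever `s` is below, respectively above,
`dim_q(μ, x)`, the points where a rational `s` separates the two dimensions in the wrong order form
a locally null set (`ae_localLqDim_le_lowerLocalDim`, `ae_upperLocalDim_le_localLqDim`).

**Entropy dimensions.** The points where `m(y, δ) ≤ δ^s` for all small dyadic `δ` are exhausted by
countably many measurable sets `E` on which the threshold is uniform. At a density point of `E` the
mean of `log m(y, δ) / log δ` is, up to `O(1 / log δ)`, at least `s` times the density of `E`,
since `log m` is bounded above off `E`. For the reverse inequality the part off `E` is not
trivially bounded; there `-log m ≤ D log (1 / δ) + δ^D / m`, and `∫ 1 / m(y, δ) dμ(y)` over a ball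
is at most the number of balls of radius `δ / 2` needed to cover it, which is `O(δ^{-D})` on a
doubling space (`IsDoublingSpace.exists_integral_inv_measure_closedBall_le`). So the part off `E`
contributes at most `D` times a density that tends to `0`.
-/

namespace LocalDim

/-! ### Power laws and logarithmic quotients -/

theorem lt_log_div_log_iff {δ : ℝ} (h0 : 0 < δ) (h1 : δ < 1) (a : ENNReal) (c : ℝ) :
    (c : EReal) < ENNReal.log a / (Real.log δ : EReal) ↔ a < ENNReal.ofReal δ ^ c := by
  have hneg : Real.log δ < 0 := Real.log_neg h0 h1
  have h := EReal.strictAnti_div_right_of_neg (b := (Real.log δ : EReal))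
    (by exact_mod_cast hneg) (EReal.coe_ne_bot _)
  have hc : (c : EReal) = ENNReal.log (ENNReal.ofReal δ ^ c) / (Real.log δ : EReal) := by
    rw [ENNReal.log_rpow, ENNReal.log_ofReal_of_pos h0, ← EReal.coe_mul, ← EReal.coe_div,
      mul_div_cancel_right₀ _ hneg.ne]
  rw [hc]
  exact h.lt_iff_gt.trans ENNReal.log_lt_log_iff

theorem log_div_log_lt_iff {δ : ℝ} (h0 : 0 < δ) (h1 : δ < 1) (a : ENNReal) (c : ℝ) :
    ENNReal.log a / (Real.log δ : EReal) < (c : EReal) ↔ ENNReal.ofReal δ ^ c < a := by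
  have hneg : Real.log δ < 0 := Real.log_neg h0 h1
  have h := EReal.strictAnti_div_right_of_neg (b := (Real.log δ : EReal))
    (by exact_mod_cast hneg) (EReal.coe_ne_bot _)
  have hc : (c : EReal) = ENNReal.log (ENNReal.ofReal δ ^ c) / (Real.log δ : EReal) := by
    rw [ENNReal.log_rpow, ENNReal.log_ofReal_of_pos h0, ← EReal.coe_mul, ← EReal.coe_div,
      mul_div_cancel_right₀ _ hneg.ne]
  rw [hc]
  exact h.lt_iff_gt.trans ENNReal.log_lt_log_iff

theorem eventually_mem_Ioo_nhdsGT {a : ℝ} (ha : 0 < a) : ∀ᶠ δ : ℝ in 𝓝[>] 0, 0 < δ ∧ δ < a :=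
  Ioo_mem_nhdsGT ha

theorem tendsto_ofReal_rpow_nhdsGT_zero {e : ℝ} (he : 0 < e) :
    Tendsto (fun δ : ℝ => ENNReal.ofReal δ ^ e) (𝓝[>] 0) (𝓝 0) := by
  have h1 : Tendsto (fun δ : ℝ => ENNReal.ofReal δ) (𝓝[>] 0) (𝓝 0) := by
    have := (ENNReal.continuous_ofReal.tendsto (0 : ℝ)).mono_left
      (nhdsWithin_le_nhds (s := Set.Ioi (0 : ℝ)))
    simpa using this
  simpa [ENNReal.zero_rpow_of_pos he] using h1.ennrpow_const e

theorem ofReal_ne_zero_of_pos {δ : ℝ} (h : 0 < δ) : ENNReal.ofReal δ ≠ 0 := by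
  simpa using h

/-- A constant factor is absorbed by an arbitrarily small loss in the exponent. -/
theorem eventually_const_mul_rpow_le {K : ENNReal} (hK : K ≠ ⊤) {c c' : ℝ} (h : c' < c) :
    ∀ᶠ δ : ℝ in 𝓝[>] 0, K * ENNReal.ofReal δ ^ c < ENNReal.ofReal δ ^ c' := by
  have ht := ENNReal.Tendsto.const_mul (tendsto_ofReal_rpow_nhdsGT_zero (sub_pos.2 h))
    (Or.inr hK) (a := K)
  rw [mul_zero] at ht
  filter_upwards [ht.eventually_lt_const one_pos, self_mem_nhdsWithin] with δ h1 h0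
  have hδ := ofReal_ne_zero_of_pos h0
  have hp : ENNReal.ofReal δ ^ c' ≠ 0 := (ENNReal.rpow_pos hδ.bot_lt ENNReal.ofReal_ne_top).ne'
  have hp' : ENNReal.ofReal δ ^ c' ≠ ⊤ := ENNReal.rpow_ne_top_of_ne_zero hδ ENNReal.ofReal_ne_top
  calc K * ENNReal.ofReal δ ^ c
      = (K * ENNReal.ofReal δ ^ (c - c')) * ENNReal.ofReal δ ^ c' := by
        rw [mul_assoc, ← ENNReal.rpow_add _ _ hδ ENNReal.ofReal_ne_top, sub_add_cancel]
    _ < 1 * ENNReal.ofReal δ ^ c' := by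
        rw [ENNReal.mul_lt_mul_iff_left hp hp']; exact h1
    _ = _ := one_mul _

theorem eventually_lt_rpow_of_lt_liminf {f : ℝ → ENNReal} {c : ℝ}
    (h : (c : EReal) < liminf (fun δ : ℝ => ENNReal.log (f δ) / (Real.log δ : EReal)) (𝓝[>] 0)) :
    ∀ᶠ δ : ℝ in 𝓝[>] 0, f δ < ENNReal.ofReal δ ^ c := by
  filter_upwards [eventually_lt_of_lt_liminf h, eventually_mem_Ioo_nhdsGT one_pos] with δ h1 h2
  exact (lt_log_div_log_iff h2.1 h2.2 _ _).1 h1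

theorem eventually_rpow_lt_of_limsup_lt {f : ℝ → ENNReal} {c : ℝ}
    (h : limsup (fun δ : ℝ => ENNReal.log (f δ) / (Real.log δ : EReal)) (𝓝[>] 0) < (c : EReal)) :
    ∀ᶠ δ : ℝ in 𝓝[>] 0, ENNReal.ofReal δ ^ c < f δ := by
  filter_upwards [eventually_lt_of_limsup_lt h, eventually_mem_Ioo_nhdsGT one_pos] with δ h1 h2
  exact (log_div_log_lt_iff h2.1 h2.2 _ _).1 h1

theorem le_liminf_of_eventually_le {f : ℝ → ENNReal} {c : ℝ} {K : ENNReal} (hK : K ≠ ⊤)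
    (h : ∀ᶠ δ : ℝ in 𝓝[>] 0, f δ ≤ K * ENNReal.ofReal δ ^ c) :
    (c : EReal) ≤ liminf (fun δ : ℝ => ENNReal.log (f δ) / (Real.log δ : EReal)) (𝓝[>] 0) := by
  refine EReal.ge_of_forall_gt_iff_ge.1 fun c' hc' => le_liminf_of_le (by isBoundedDefault) ?_
  filter_upwards [h, eventually_const_mul_rpow_le hK (EReal.coe_lt_coe_iff.1 hc'),
    eventually_mem_Ioo_nhdsGT one_pos] with δ h1 h2 h3
  exact ((lt_log_div_log_iff h3.1 h3.2 _ _).2 (h1.trans_lt h2)).le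

theorem limsup_le_of_eventually_le {f : ℝ → ENNReal} {c : ℝ} {K : ENNReal} (hK : K ≠ ⊤)
    (h : ∀ᶠ δ : ℝ in 𝓝[>] 0, ENNReal.ofReal δ ^ c ≤ K * f δ) :
    limsup (fun δ : ℝ => ENNReal.log (f δ) / (Real.log δ : EReal)) (𝓝[>] 0) ≤ (c : EReal) := by
  refine EReal.le_of_forall_lt_iff_le.1 fun c' hc' => limsup_le_of_le (by isBoundedDefault) ?_
  filter_upwards [h, eventually_const_mul_rpow_le hK (EReal.coe_lt_coe_iff.1 hc'),
    eventually_mem_Ioo_nhdsGT one_pos] with δ h1 h2 h3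
  refine ((log_div_log_lt_iff h3.1 h3.2 _ _).2 ?_).le
  by_contra hf
  exact (h2.trans_le h1).not_ge (mul_le_mul_right (not_lt.1 hf) _)

/-! ### Covering numbers -/

/-- Iterated halving: a closed ball is covered by `N ^ k` closed balls of radius `r / 2 ^ k`. -/
theorem exists_finset_cover_pow {X : Type*} [MetricSpace X] {N : ℕ} (hN : ∀ (x : X) (r : ℝ), 0 < r →
    ∃ t : Finset X, t.card ≤ N ∧ closedBall x r ⊆ ⋃ y ∈ t, closedBall y (r / 2))
    (k : ℕ) (x : X) {r : ℝ} (hr : 0 < r) :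
    ∃ t : Finset X, t.card ≤ N ^ k ∧ closedBall x r ⊆ ⋃ y ∈ t, closedBall y (r / 2 ^ k) := by
  classical
  induction k generalizing x r with
  | zero => exact ⟨{x}, by simp, by simp⟩
  | succ k ih =>
    obtain ⟨t, ht, htc⟩ := hN x r hr
    choose f hf hfc using fun y => ih y (half_pos hr)
    refine ⟨t.biUnion f, ?_, htc.trans ?_⟩
    · calc (t.biUnion f).card ≤ t.card * N ^ k := Finset.card_biUnion_le_card_mul _ _ _
            fun y _ => hf y
        _ ≤ N * N ^ k := Nat.mul_le_mul_right _ ht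
        _ = N ^ (k + 1) := by rw [pow_succ, mul_comm]
    · refine Set.iUnion₂_subset fun y hy => (hfc y).trans (Set.iUnion₂_subset fun z hz => ?_)
      rw [div_div, ← pow_succ']
      exact Set.subset_biUnion_of_mem (u := fun z => closedBall z (r / 2 ^ (k + 1)))
        (Finset.mem_biUnion.2 ⟨y, hy, hz⟩)

/-! ### Monotonicity of the local `L^q`-dimensions -/

variable {X : Type*} [MetricSpace X] [MeasurableSpace X]

theorem localLqSpectrum_eq_iSup (μ : Measure X) (q : ℝ) (x : X) :
    localLqSpectrum μ q x = ⨆ r : Set.Ioi (0 : ℝ), lqSpectrumAtScale μ q x r := by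
  refine tendsto_nhds_unique (tendsto_localLqSpectrum μ q x) ?_
  have := (lqSpectrumAtScale_antitone μ q x).tendsto_nhdsGT 0
  rwa [sSup_image'] at this

theorem lqSpectrumAtScale_le_localLqSpectrum (μ : Measure X) (q : ℝ) (x : X) {r : ℝ}
    (hr : 0 < r) : lqSpectrumAtScale μ q x r ≤ localLqSpectrum μ q x := by
  rw [localLqSpectrum_eq_iSup]
  exact le_iSup (fun r : Set.Ioi (0 : ℝ) => lqSpectrumAtScale μ q x r) ⟨r, hr⟩

theorem exists_lt_lqSpectrumAtScale {μ : Measure X} {q : ℝ} {x : X} {c : EReal}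
    (h : c < localLqSpectrum μ q x) : ∃ r : ℝ, 0 < r ∧ c < lqSpectrumAtScale μ q x r := by
  rw [localLqSpectrum_eq_iSup, lt_iSup_iff] at h
  obtain ⟨r, hr⟩ := h
  exact ⟨r, r.2, hr⟩

theorem measure_closedBall_ne_zero {μ : Measure X} {x : X} (hx : x ∈ μ.support) {δ : ℝ}
    (hδ : 0 < δ) : μ (closedBall x δ) ≠ 0 :=
  (Measure.mem_support_iff_forall x |>.1 hx _ (closedBall_mem_nhds x hδ)).ne'

theorem IsPacking.tsum_measure_le [OpensMeasurableSpace X] {μ : Measure X} {x : X} {r δ : ℝ}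
    {C : Set X} (hC : IsPacking δ (closedBall x r ∩ μ.support) C) :
    ∑' c : C, μ (closedBall (c : X) δ) ≤ μ (closedBall x (r + δ)) := by
  rw [← measure_biUnion hC.countable hC.pairwiseDisjoint fun _ _ => measurableSet_closedBall]
  refine measure_mono (Set.iUnion₂_subset fun c hc => closedBall_subset_closedBall' ?_)
  have := mem_closedBall.1 (hC.subset hc).1
  linarith

theorem tsum_rpow_mul_rpow_le {ι : Type*} (f g : ι → ENNReal) {t : ℝ} (h0 : 0 ≤ t) (h1 : t ≤ 1) :
    ∑' i, f i ^ (1 - t) * g i ^ t ≤ (∑' i, f i) ^ (1 - t) * (∑' i, g i) ^ t := by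
  let _ : MeasurableSpace ι := ⊤
  simpa only [lintegral_count] using ENNReal.lintegral_mul_norm_pow_le (μ := Measure.count)
    (measurable_from_top (f := f)).aemeasurable (measurable_from_top (f := g)).aemeasurable
    (sub_nonneg.2 h1) h0 (by ring)

/-- Hölder's inequality for packing sums, between the exponents `1` and `p`. -/
theorem packingSum_le_mul_rpow [OpensMeasurableSpace X] {μ : Measure X}
    (hfin : ∀ (y : X) (s : ℝ), μ (closedBall y s) ≠ ⊤) {p q t : ℝ} (h0 : 0 ≤ t) (h1 : t ≤ 1)
    (hq : q = 1 - t + p * t) (x : X) (r : ℝ) {δ : ℝ} (hδ : 0 < δ) :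
    packingSum μ q δ r x ≤ μ (closedBall x (r + δ)) ^ (1 - t) * packingSum μ p δ r x ^ t := by
  refine iSup₂_le fun C hC => ?_
  calc ∑' c : C, μ (closedBall (c : X) δ) ^ q
      = ∑' c : C, μ (closedBall (c : X) δ) ^ (1 - t) * (μ (closedBall (c : X) δ) ^ p) ^ t := by
        refine tsum_congr fun c => ?_
        rw [hq, ENNReal.rpow_add _ _ (measure_closedBall_ne_zero (hC.subset c.2).2 hδ) (hfin _ _),
          ENNReal.rpow_mul]
    _ ≤ _ := tsum_rpow_mul_rpow_le _ _ h0 h1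
    _ ≤ _ := mul_le_mul' (ENNReal.rpow_le_rpow hC.tsum_measure_le (sub_nonneg.2 h1))
        (ENNReal.rpow_le_rpow (le_iSup₂_of_le C hC le_rfl) h0)

/-- With `q = 1 - t + p t`, that is `t = (q - 1) / (p - 1)`, this is `t τ_p ≤ τ_q`. -/
theorem mul_le_localLqSpectrum [OpensMeasurableSpace X] {μ : Measure X}
    (hfin : ∀ (y : X) (s : ℝ), μ (closedBall y s) ≠ ⊤) {p q t : ℝ} (h0 : 0 ≤ t) (h1 : t ≤ 1)
    (hq : q = 1 - t + p * t) {x : X} {c : ℝ} (h : (c : EReal) < localLqSpectrum μ p x) :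
    ((c * t : ℝ) : EReal) ≤ localLqSpectrum μ q x := by
  obtain ⟨r, hr, hc⟩ := exists_lt_lqSpectrumAtScale h
  refine le_trans ?_ (lqSpectrumAtScale_le_localLqSpectrum μ q x hr)
  refine le_liminf_of_eventually_le (K := μ (closedBall x (r + 1)) ^ (1 - t))
    (ENNReal.rpow_ne_top_of_nonneg (sub_nonneg.2 h1) (hfin _ _)) ?_
  filter_upwards [eventually_lt_rpow_of_lt_liminf hc,
    eventually_mem_Ioo_nhdsGT one_pos] with δ hS hδ
  refine (packingSum_le_mul_rpow hfin h0 h1 hq x r hδ.1).trans (mul_le_mul' ?_ ?_)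
  · exact ENNReal.rpow_le_rpow (measure_mono (closedBall_subset_closedBall (by linarith [hδ.2])))
      (sub_nonneg.2 h1)
  · rw [ENNReal.rpow_mul]
    exact ENNReal.rpow_le_rpow hS.le h0

theorem lt_localLqDim_iff (μ : Measure X) {q : ℝ} (hq : 1 < q) (x : X) (c : ℝ) :
    (c : EReal) < localLqDim μ q x ↔ ((c * (q - 1) : ℝ) : EReal) < localLqSpectrum μ q x := by
  rw [localLqDim, EReal.lt_div_iff (by exact_mod_cast sub_pos.2 hq) (EReal.coe_ne_top _),
    ← EReal.coe_mul]

theorem le_localLqDim_iff (μ : Measure X) {q : ℝ} (hq : 1 < q) (x : X) (c : ℝ) :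
    (c : EReal) ≤ localLqDim μ q x ↔ ((c * (q - 1) : ℝ) : EReal) ≤ localLqSpectrum μ q x := by
  rw [localLqDim, EReal.le_div_iff_mul_le (by exact_mod_cast sub_pos.2 hq) (EReal.coe_ne_top _),
    ← EReal.coe_mul]

theorem localLqDim_le_iff (μ : Measure X) {q : ℝ} (hq : q < 1) (x : X) (c : ℝ) :
    localLqDim μ q x ≤ (c : EReal) ↔ ((c * (q - 1) : ℝ) : EReal) ≤ localLqSpectrum μ q x := by
  have hneg : q - 1 < 0 := sub_neg.2 hq
  have h := EReal.strictAnti_div_right_of_neg (b := ((q - 1 : ℝ) : EReal))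
    (by exact_mod_cast hneg) (EReal.coe_ne_bot _)
  rw [← h.le_iff_ge (b := ((c * (q - 1) : ℝ) : EReal)), localLqDim, ← EReal.coe_div,
    mul_div_cancel_right₀ _ hneg.ne]

theorem localLqDim_lt_iff (μ : Measure X) {q : ℝ} (hq : q < 1) (x : X) (c : ℝ) :
    localLqDim μ q x < (c : EReal) ↔ ((c * (q - 1) : ℝ) : EReal) < localLqSpectrum μ q x := by
  have hneg : q - 1 < 0 := sub_neg.2 hq
  have h := EReal.strictAnti_div_right_of_neg (b := ((q - 1 : ℝ) : EReal))
    (by exact_mod_cast hneg) (EReal.coe_ne_bot _)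
  rw [← h.lt_iff_gt (b := ((c * (q - 1) : ℝ) : EReal)), localLqDim, ← EReal.coe_div,
    mul_div_cancel_right₀ _ hneg.ne]

theorem localLqDim_antitoneOn_Ioi [OpensMeasurableSpace X] {μ : Measure X}
    (hfin : ∀ (y : X) (s : ℝ), μ (closedBall y s) ≠ ⊤) (x : X) :
    AntitoneOn (fun q => localLqDim μ q x) (Set.Ioi 1) := by
  intro q hq p hp hqp
  have hq' : 0 < q - 1 := sub_pos.2 hq
  have hp' : 0 < p - 1 := sub_pos.2 hp
  refine EReal.ge_of_forall_gt_iff_ge.1 fun c hc => (le_localLqDim_iff μ hq x c).2 ?_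
  have := mul_le_localLqSpectrum hfin (q := q) (t := (q - 1) / (p - 1)) (by positivity)
    ((div_le_one hp').2 (by linarith)) (by field_simp; ring) ((lt_localLqDim_iff μ hp x c).1 hc)
  rwa [mul_assoc, mul_div_cancel₀ _ hp'.ne'] at this

theorem localLqDim_antitoneOn_Iio [OpensMeasurableSpace X] {μ : Measure X}
    (hfin : ∀ (y : X) (s : ℝ), μ (closedBall y s) ≠ ⊤) (x : X) :
    AntitoneOn (fun q => localLqDim μ q x) (Set.Iio 1) := by
  intro p hp q hq hpq
  have hq' : q - 1 < 0 := sub_neg.2 hq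
  have hp' : p - 1 < 0 := sub_neg.2 hp
  refine EReal.le_of_forall_lt_iff_le.1 fun c hc => (localLqDim_le_iff μ hq x c).2 ?_
  have := mul_le_localLqSpectrum hfin (q := q) (t := (q - 1) / (p - 1))
    (div_nonneg_of_nonpos hq'.le hp'.le)
    ((div_le_one_of_neg hp').2 (by linarith)) (by have := hp'.ne; field_simp; ring)
    ((localLqDim_lt_iff μ hp x c).1 hc)
  rwa [mul_assoc, mul_div_cancel₀ _ hp'.ne] at this

/-! ### Dyadic radii -/

theorem rpow_le_rpow_of_nonpos {a b : ENNReal} (h : a ≤ b) {s : ℝ} (hs : s ≤ 0) :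
    b ^ s ≤ a ^ s := by
  rw [← neg_neg s, ENNReal.rpow_neg, ENNReal.rpow_neg a]
  exact ENNReal.inv_le_inv.2 (ENNReal.rpow_le_rpow h (neg_nonneg.2 hs))

/-- Powers, of either sign, of comparable quantities are comparable. -/
theorem rpow_le_two_rpow_abs_mul_rpow {a b : ENNReal} (h : b ≤ a) (h' : a ≤ 2 * b) (s : ℝ) :
    a ^ s ≤ 2 ^ |s| * b ^ s := by
  rcases le_total 0 s with hs | hs
  · rw [abs_of_nonneg hs, ← ENNReal.mul_rpow_of_nonneg _ _ hs]
    exact ENNReal.rpow_le_rpow h' hs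
  · calc a ^ s ≤ b ^ s := rpow_le_rpow_of_nonpos h hs
      _ ≤ 2 ^ |s| * b ^ s := le_mul_of_one_le_left' <| by
          simpa using ENNReal.rpow_le_rpow_of_exponent_le (x := 2) (by norm_num) (abs_nonneg s)

theorem tendsto_half_pow_nhdsGT_zero :
    Tendsto (fun n : ℕ => (1 / 2 : ℝ) ^ n) atTop (𝓝[>] 0) :=
  tendsto_nhdsWithin_iff.2 ⟨tendsto_pow_atTop_nhds_zero_of_lt_one (by norm_num) (by norm_num),
    Eventually.of_forall fun n => by simp⟩

theorem exists_dyadic_near {k : ℕ} {δ : ℝ} (h0 : 0 < δ) (hk : δ ≤ (1 / 2) ^ k) :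
    ∃ n, k ≤ n ∧ (1 / 2) ^ (n + 1) ≤ δ ∧ δ ≤ (1 / 2) ^ n := by
  obtain ⟨n, h1, h2⟩ := exists_nat_pow_near_of_lt_one h0
    (hk.trans (pow_le_one₀ (by norm_num) (by norm_num))) (y := 1 / 2) (by norm_num) (by norm_num)
  refine ⟨n, ?_, h1.le, h2⟩
  have := (pow_lt_pow_iff_right_of_lt_one₀ (by norm_num) (by norm_num)).1 (h1.trans_le hk)
  omega

theorem measure_closedBall_le_of_dyadic {μ : Measure X} {y : X} {s : ℝ} {k : ℕ}
    (h : ∀ n ≥ k, μ (closedBall y ((1 / 2) ^ n)) ≤ ENNReal.ofReal ((1 / 2) ^ n) ^ s)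
    {δ : ℝ} (h0 : 0 < δ) (hk : δ ≤ (1 / 2) ^ k) :
    μ (closedBall y δ) ≤ 2 ^ |s| * ENNReal.ofReal δ ^ s := by
  obtain ⟨n, hn, h1, h2⟩ := exists_dyadic_near h0 hk
  refine (measure_mono (closedBall_subset_closedBall h2)).trans ((h n hn).trans ?_)
  refine rpow_le_two_rpow_abs_mul_rpow (ENNReal.ofReal_le_ofReal h2) ?_ s
  rw [← ENNReal.ofReal_ofNat 2, ← ENNReal.ofReal_mul (by norm_num)]
  refine ENNReal.ofReal_le_ofReal ?_
  rw [pow_succ] at h1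
  linarith

theorem le_measure_closedBall_of_dyadic {μ : Measure X} {y : X} {s : ℝ} {k : ℕ}
    (h : ∀ n ≥ k, ENNReal.ofReal ((1 / 2) ^ n) ^ s ≤ μ (closedBall y ((1 / 2) ^ n)))
    {δ : ℝ} (h0 : 0 < δ) (hk : δ ≤ (1 / 2) ^ k) :
    ENNReal.ofReal δ ^ s ≤ 2 ^ |s| * μ (closedBall y δ) := by
  obtain ⟨n, hn, h1, h2⟩ := exists_dyadic_near h0 hk
  refine le_trans ?_ (mul_le_mul_right ((h (n + 1) (by omega)).trans
    (measure_mono (closedBall_subset_closedBall h1))) _)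
  refine rpow_le_two_rpow_abs_mul_rpow (ENNReal.ofReal_le_ofReal h1) ?_ s
  rw [← ENNReal.ofReal_ofNat 2, ← ENNReal.ofReal_mul (by norm_num)]
  refine ENNReal.ofReal_le_ofReal ?_
  rw [pow_succ]
  linarith

theorem le_lowerLocalDim_of_dyadic {μ : Measure X} {y : X} {s : ℝ}
    (h : ∀ᶠ n : ℕ in atTop, μ (closedBall y ((1 / 2) ^ n)) ≤ ENNReal.ofReal ((1 / 2) ^ n) ^ s) :
    (s : EReal) ≤ lowerLocalDim μ y := by
  obtain ⟨k, hk⟩ := eventually_atTop.1 h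
  refine le_liminf_of_eventually_le (K := 2 ^ |s|) (by finiteness) ?_
  filter_upwards [eventually_mem_Ioo_nhdsGT (show (0 : ℝ) < (1 / 2) ^ k by positivity)] with δ hδ
  exact measure_closedBall_le_of_dyadic hk hδ.1 hδ.2.le

theorem upperLocalDim_le_of_dyadic {μ : Measure X} {y : X} {s : ℝ}
    (h : ∀ᶠ n : ℕ in atTop, ENNReal.ofReal ((1 / 2) ^ n) ^ s ≤ μ (closedBall y ((1 / 2) ^ n))) :
    upperLocalDim μ y ≤ (s : EReal) := by
  obtain ⟨k, hk⟩ := eventually_atTop.1 h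
  refine limsup_le_of_eventually_le (K := 2 ^ |s|) (by finiteness) ?_
  filter_upwards [eventually_mem_Ioo_nhdsGT (show (0 : ℝ) < (1 / 2) ^ k by positivity)] with δ hδ
  exact le_measure_closedBall_of_dyadic hk hδ.1 hδ.2.le

/-! ### Packings carrying a definite part of the measure -/

/-- A `δ`-packing of a bounded set `A` may be chosen to carry a fixed part of the measure of `A`:
the Vitali-type selection is made by the measures of the balls, all of the same radius. -/
theorem exists_isPacking_measure_le [SecondCountableTopology X] {N : ℕ}
    (hN : ∀ (x : X) (r : ℝ), 0 < r →
      ∃ t : Finset X, t.card ≤ N ∧ closedBall x r ⊆ ⋃ y ∈ t, closedBall y (r / 2))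
    {μ : Measure X} (hfin : ∀ (y : X) (s : ℝ), μ (closedBall y s) ≠ ⊤) {δ : ℝ} (hδ : 0 < δ)
    {A : Set X} {x : X} {r : ℝ} (hA : A ⊆ closedBall x r) :
    ∃ C, IsPacking δ A C ∧ μ A ≤ 2 * N ^ 2 * ∑' c : C, μ (closedBall (c : X) δ) := by
  obtain ⟨C, hCA, hdisj, hC⟩ := Vitali.exists_disjoint_subfamily_covering_enlargement
    (fun y => closedBall y δ) A (fun y => μ.real (closedBall y δ)) 2 one_lt_two
    (fun _ _ => measureReal_nonneg) (μ.real (closedBall x (r + δ)))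
    (fun y hy => measureReal_mono (closedBall_subset_closedBall' (by
      have := mem_closedBall.1 (hA hy); linarith)) (hfin _ _))
    (fun y _ => ⟨y, mem_closedBall_self hδ.le⟩)
  have hcount : C.Countable := hdisj.countable_of_nonempty_interior fun y _ =>
    ⟨y, ball_subset_interior_closedBall (mem_ball_self hδ)⟩
  refine ⟨C, ⟨hcount, hCA, hdisj⟩, ?_⟩
  -- contains the points of `A` that the selection assigns to `c`
  set F : X → Set X := fun c =>
    {y | y ∈ closedBall c (2 * δ) ∧ μ (closedBall y δ) ≤ 2 * μ (closedBall c δ)}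
  have hAF : A ⊆ ⋃ c ∈ C, F c := by
    intro y hy
    obtain ⟨c, hc, ⟨z, hzy, hzc⟩, hyc⟩ := hC y hy
    refine Set.mem_iUnion₂.2 ⟨c, hc, mem_closedBall.2 ?_, ?_⟩
    · have := dist_triangle_left y c z
      rw [mem_closedBall] at hzy hzc
      linarith
    · rw [← ENNReal.ofReal_toReal (hfin y δ), ← ENNReal.ofReal_toReal (hfin c δ),
        ← ENNReal.ofReal_ofNat 2, ← ENNReal.ofReal_mul (by norm_num)]
      exact ENNReal.ofReal_le_ofReal hyc
  have hF : ∀ c, μ (F c) ≤ 2 * N ^ 2 * μ (closedBall c δ) := by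
    intro c
    -- two halvings cover `B(c, 2δ)` by balls of radius `δ / 2`, so of diameter at most `δ`
    obtain ⟨t, htN, ht⟩ := exists_finset_cover_pow hN 2 c (r := 2 * δ) (by linarith)
    have hsub : F c ⊆ ⋃ z ∈ t, (F c ∩ closedBall z (2 * δ / 2 ^ 2)) := by
      intro y hy
      obtain ⟨z, hz, hyz⟩ := Set.mem_iUnion₂.1 (ht hy.1)
      exact Set.mem_iUnion₂.2 ⟨z, hz, hy, hyz⟩
    have hpiece : ∀ z, μ (F c ∩ closedBall z (2 * δ / 2 ^ 2)) ≤ 2 * μ (closedBall c δ) := by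
      intro z
      rcases Set.eq_empty_or_nonempty (F c ∩ closedBall z (2 * δ / 2 ^ 2)) with h | ⟨y, hy, hyz⟩
      · simp [h]
      · refine (measure_mono fun w hw => ?_).trans hy.2
        have := dist_triangle_right w y z
        have hw := mem_closedBall.1 hw.2
        rw [mem_closedBall] at hyz ⊢
        linarith
    calc μ (F c) ≤ ∑ z ∈ t, μ (F c ∩ closedBall z (2 * δ / 2 ^ 2)) :=
          (measure_mono hsub).trans (measure_biUnion_finset_le _ _)
      _ ≤ t.card • (2 * μ (closedBall c δ)) := Finset.sum_le_card_nsmul _ _ _ fun z _ => hpiece z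
      _ ≤ (N ^ 2 : ℕ) • (2 * μ (closedBall c δ)) := nsmul_le_nsmul_left (zero_le) htN
      _ = 2 * N ^ 2 * μ (closedBall c δ) := by rw [nsmul_eq_mul]; push_cast; ring
  calc μ A ≤ ∑' c : C, μ (F c) := (measure_mono hAF).trans (measure_biUnion_le _ hcount _)
    _ ≤ ∑' c : C, 2 * N ^ 2 * μ (closedBall (c : X) δ) := ENNReal.tsum_le_tsum fun c => hF c
    _ = _ := ENNReal.tsum_mul_left

/-! ### Local dimensions and local `L^q`-dimensions -/

/-- Chebyshev's inequality for packing sums. For `q > 1` the set on the left consists of points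
whose `δ`-ball has measure at least `a`, for `q < 1` of those where it has measure at most `a`. -/
theorem measure_rpow_le_le_packingSum [SecondCountableTopology X] {N : ℕ}
    (hN : ∀ (x : X) (r : ℝ), 0 < r →
      ∃ t : Finset X, t.card ≤ N ∧ closedBall x r ⊆ ⋃ y ∈ t, closedBall y (r / 2))
    {μ : Measure X} (hfin : ∀ (y : X) (s : ℝ), μ (closedBall y s) ≠ ⊤) {δ : ℝ} (hδ : 0 < δ)
    (q : ℝ) (a : ENNReal) (x : X) (r : ℝ) :
    μ {y | y ∈ closedBall x r ∩ μ.support ∧ μ (closedBall y δ) ^ (1 - q) ≤ a ^ (1 - q)} ≤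
      2 * N ^ 2 * (a ^ (1 - q) * packingSum μ q δ r x) := by
  obtain ⟨C, hC, hle⟩ := exists_isPacking_measure_le hN hfin hδ
    (A := {y | y ∈ closedBall x r ∩ μ.support ∧ μ (closedBall y δ) ^ (1 - q) ≤ a ^ (1 - q)})
    fun y hy => hy.1.1
  refine hle.trans (mul_le_mul_right ?_ _)
  have hC' : IsPacking δ (closedBall x r ∩ μ.support) C :=
    ⟨hC.countable, fun c hc => (hC.subset hc).1, hC.pairwiseDisjoint⟩
  have hS : ∑' c : C, μ (closedBall (c : X) δ) ^ q ≤ packingSum μ q δ r x :=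
    le_iSup₂_of_le C hC' le_rfl
  calc ∑' c : C, μ (closedBall (c : X) δ)
      ≤ ∑' c : C, a ^ (1 - q) * μ (closedBall (c : X) δ) ^ q := by
        refine ENNReal.tsum_le_tsum fun c => ?_
        have hc := hC.subset c.2
        calc μ (closedBall (c : X) δ)
            = μ (closedBall (c : X) δ) ^ (1 - q) * μ (closedBall (c : X) δ) ^ q := by
              rw [← ENNReal.rpow_add _ _ (measure_closedBall_ne_zero hc.1.2 hδ) (hfin _ _),
                sub_add_cancel, ENNReal.rpow_one]
          _ ≤ _ := mul_le_mul_left hc.2 _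
    _ = a ^ (1 - q) * ∑' c : C, μ (closedBall (c : X) δ) ^ q := ENNReal.tsum_mul_left
    _ ≤ a ^ (1 - q) * packingSum μ q δ r x := mul_le_mul_right hS _

/-- The Borel–Cantelli argument along dyadic radii, for `q > 1` and `q < 1` at once. -/
theorem ae_eventually_rpow_lt_measure_closedBall [OpensMeasurableSpace X]
    (hX : IsDoublingSpace X) {μ : Measure X}
    (hfin : ∀ (y : X) (s : ℝ), μ (closedBall y s) ≠ ⊤) {q s : ℝ} {x : X} {r : ℝ}
    (h : ((s * (q - 1) : ℝ) : EReal) < lqSpectrumAtScale μ q x r) :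
    ∀ᵐ y ∂μ, y ∈ closedBall x r → ∀ᶠ n : ℕ in atTop,
      (ENNReal.ofReal ((1 / 2) ^ n) ^ s) ^ (1 - q) < μ (closedBall y ((1 / 2) ^ n)) ^ (1 - q) := by
  have := hX.secondCountable
  obtain ⟨N, -, hN⟩ := hX
  -- the gap between `s (q - 1)` and `c` lets the measures below be summed geometrically
  obtain ⟨c, hc, hc'⟩ := EReal.lt_iff_exists_real_btwn.1 h
  have he : 0 < c - s * (q - 1) := sub_pos.2 (EReal.coe_lt_coe_iff.1 hc)
  obtain ⟨n₀, hn₀⟩ := eventually_atTop.1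
    (tendsto_half_pow_nhdsGT_zero.eventually (eventually_lt_rpow_of_lt_liminf hc'))
  set A : ℕ → Set X := fun n => {y | y ∈ closedBall x r ∩ μ.support ∧
    μ (closedBall y ((1 / 2) ^ n)) ^ (1 - q) ≤ (ENNReal.ofReal ((1 / 2) ^ n) ^ s) ^ (1 - q)}
  set ρ : ENNReal := ENNReal.ofReal (1 / 2) ^ (c - s * (q - 1))
  have hρ : ρ < 1 := ENNReal.rpow_lt_one (by simp) he
  have hA : ∀ n ≥ n₀, μ (A n) ≤ 2 * N ^ 2 * ρ ^ n := by
    intro n hn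
    have hδ : (0 : ℝ) < (1 / 2) ^ n := by positivity
    refine (measure_rpow_le_le_packingSum hN hfin hδ q _ x r).trans (mul_le_mul_right ?_ _)
    refine (mul_le_mul_right (hn₀ n hn).le _).trans_eq ?_
    rw [← ENNReal.rpow_mul, ← ENNReal.rpow_add _ _ (ofReal_ne_zero_of_pos hδ)
      ENNReal.ofReal_ne_top, ENNReal.ofReal_pow (by norm_num), ← ENNReal.rpow_natCast,
      ← ENNReal.rpow_mul, ← ENNReal.rpow_natCast, ← ENNReal.rpow_mul]
    congr 1
    ring
  have hsum : ∑' n, μ (A (n + n₀)) ≠ ⊤ := by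
    refine ne_top_of_le_ne_top (b := ∑' n, 2 * (N : ENNReal) ^ 2 * ρ ^ n) ?_
      (ENNReal.tsum_le_tsum fun n => (hA _ (by omega)).trans
        (mul_le_mul_right (pow_le_pow_right_of_le_one' hρ.le (by omega)) _))
    rw [ENNReal.tsum_mul_left, ENNReal.tsum_geometric]
    exact ENNReal.mul_ne_top (by finiteness) (ENNReal.inv_ne_top.2 (tsub_pos_of_lt hρ).ne')
  filter_upwards [ae_eventually_notMem hsum, Measure.support_mem_ae (μ := μ)] with y hy hys hyx
  have hy' : ∀ᶠ n in map (fun n => n + n₀) atTop, y ∉ A n := eventually_map.2 hy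
  rw [map_add_atTop_eq_nat] at hy'
  filter_upwards [hy'] with n hn
  by_contra hcon
  exact hn ⟨⟨hyx, hys⟩, not_lt.1 hcon⟩

theorem ae_localLqDim_le_lowerLocalDim [OpensMeasurableSpace X]
    (hX : IsDoublingSpace X) {μ : Measure X}
    (hfin : ∀ (y : X) (s : ℝ), μ (closedBall y s) ≠ ⊤) {q : ℝ} (hq : 1 < q) :
    ∀ᵐ x ∂μ, localLqDim μ q x ≤ lowerLocalDim μ x := by
  have := hX.secondCountable
  have key : ∀ s : ℚ, ∀ᵐ x ∂μ,
      ¬ (lowerLocalDim μ x < ((s : ℝ) : EReal) ∧ ((s : ℝ) : EReal) < localLqDim μ q x) := by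
    intro s
    rw [ae_iff]
    simp only [not_not]
    refine measure_null_of_locally_null _ fun x hx => ?_
    obtain ⟨r, hr, h⟩ := exists_lt_lqSpectrumAtScale ((lt_localLqDim_iff μ hq x s).1 hx.2)
    refine ⟨_, inter_mem_nhdsWithin _ (closedBall_mem_nhds x hr), measure_mono_null ?_
      (ae_iff.1 (ae_eventually_rpow_lt_measure_closedBall hX hfin h))⟩
    rintro y ⟨hy, hyx⟩ hcon
    refine hy.1.not_ge (le_lowerLocalDim_of_dyadic ?_)
    filter_upwards [hcon hyx] with n hn
    by_contra hlt
    exact hn.not_ge (rpow_le_rpow_of_nonpos (not_le.1 hlt).le (by linarith))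
  filter_upwards [ae_all_iff.2 key] with x hx
  by_contra hlt
  obtain ⟨s, h1, h2⟩ := EReal.lt_iff_exists_rat_btwn.1 (not_le.1 hlt)
  exact hx s ⟨h1, h2⟩

theorem ae_upperLocalDim_le_localLqDim [OpensMeasurableSpace X]
    (hX : IsDoublingSpace X) {μ : Measure X}
    (hfin : ∀ (y : X) (s : ℝ), μ (closedBall y s) ≠ ⊤) {q : ℝ} (hq : q < 1) :
    ∀ᵐ x ∂μ, upperLocalDim μ x ≤ localLqDim μ q x := by
  have := hX.secondCountable
  have key : ∀ s : ℚ, ∀ᵐ x ∂μ,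
      ¬ (localLqDim μ q x < ((s : ℝ) : EReal) ∧ ((s : ℝ) : EReal) < upperLocalDim μ x) := by
    intro s
    rw [ae_iff]
    simp only [not_not]
    refine measure_null_of_locally_null _ fun x hx => ?_
    obtain ⟨r, hr, h⟩ := exists_lt_lqSpectrumAtScale ((localLqDim_lt_iff μ hq x s).1 hx.1)
    refine ⟨_, inter_mem_nhdsWithin _ (closedBall_mem_nhds x hr), measure_mono_null ?_
      (ae_iff.1 (ae_eventually_rpow_lt_measure_closedBall hX hfin h))⟩
    rintro y ⟨hy, hyx⟩ hcon
    refine hy.2.not_ge (upperLocalDim_le_of_dyadic ?_)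
    filter_upwards [hcon hyx] with n hn
    exact ((ENNReal.rpow_lt_rpow_iff (by linarith)).1 hn).le
  filter_upwards [ae_all_iff.2 key] with x hx
  by_contra hlt
  obtain ⟨s, h1, h2⟩ := EReal.lt_iff_exists_rat_btwn.1 (not_le.1 hlt)
  exact hx s ⟨h1, h2⟩

theorem lowerLocalDim_le_upperLocalDim (μ : Measure X) (x : X) :
    lowerLocalDim μ x ≤ upperLocalDim μ x :=
  liminf_le_limsup

theorem ae_exists_tendsto_localLqDim [OpensMeasurableSpace X]
    (hX : IsDoublingSpace X) {μ : Measure X} (hfin : ∀ (y : X) (s : ℝ), μ (closedBall y s) ≠ ⊤) :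
    ∀ᵐ x ∂μ, ∃ a b : EReal,
      Tendsto (fun q : ℝ => localLqDim μ q x) (𝓝[>] 1) (𝓝 a) ∧
      Tendsto (fun q : ℝ => localLqDim μ q x) (𝓝[<] 1) (𝓝 b) ∧
      a ≤ lowerLocalDim μ x ∧ lowerLocalDim μ x ≤ upperLocalDim μ x ∧ upperLocalDim μ x ≤ b := by
  have hpos : ∀ n : ℕ, (0 : ℝ) < 1 / ((n : ℝ) + 1) := fun n => Nat.one_div_pos_of_nat
  have hgt : ∀ᵐ x ∂μ, ∀ n : ℕ, localLqDim μ (1 + 1 / ((n : ℝ) + 1)) x ≤ lowerLocalDim μ x :=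
    ae_all_iff.2 fun n => ae_localLqDim_le_lowerLocalDim hX hfin (by linarith [hpos n])
  have hlt : ∀ᵐ x ∂μ, ∀ n : ℕ, upperLocalDim μ x ≤ localLqDim μ (1 - 1 / ((n : ℝ) + 1)) x :=
    ae_all_iff.2 fun n => ae_upperLocalDim_le_localLqDim hX hfin (by linarith [hpos n])
  have htgt : Tendsto (fun n : ℕ => 1 + 1 / ((n : ℝ) + 1)) atTop (𝓝[>] 1) := by
    refine tendsto_nhdsWithin_iff.2 ⟨?_, Eventually.of_forall fun n => by
      simpa using Nat.cast_add_one_pos (α := ℝ) n⟩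
    simpa using tendsto_one_div_add_atTop_nhds_zero_nat.const_add (1 : ℝ)
  have htlt : Tendsto (fun n : ℕ => 1 - 1 / ((n : ℝ) + 1)) atTop (𝓝[<] 1) := by
    refine tendsto_nhdsWithin_iff.2 ⟨?_, Eventually.of_forall fun n => by
      simpa using Nat.cast_add_one_pos (α := ℝ) n⟩
    simpa using tendsto_one_div_add_atTop_nhds_zero_nat.const_sub (1 : ℝ)
  filter_upwards [hgt, hlt] with x hxgt hxlt
  have ha := (localLqDim_antitoneOn_Ioi hfin x).tendsto_nhdsGT (OrderTop.bddAbove _)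
  have hb := (localLqDim_antitoneOn_Iio hfin x).tendsto_nhdsLT (OrderBot.bddBelow _)
  exact ⟨_, _, ha, hb, le_of_tendsto' (ha.comp htgt) hxgt, lowerLocalDim_le_upperLocalDim μ x,
    ge_of_tendsto' (hb.comp htlt) hxlt⟩

/-! ### Entropy dimensions -/

theorem tendsto_log_nhdsGT_zero : Tendsto Real.log (𝓝[>] 0) atBot :=
  Real.tendsto_log_nhdsNE_zero.mono_left (nhdsWithin_mono _ fun _ h => ne_of_gt h)

theorem tendsto_add_div_log (a C : ℝ) :
    Tendsto (fun δ : ℝ => ((a + C / Real.log δ : ℝ) : EReal)) (𝓝[>] 0) (𝓝 (a : EReal)) := by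
  have : Tendsto (fun δ : ℝ => C / Real.log δ) (𝓝[>] 0) (𝓝 0) :=
    tendsto_log_nhdsGT_zero.const_div_atBot C
  exact EReal.tendsto_coe.2 (by simpa using this.const_add a)

theorem le_liminf_entropyQuotient {μ : Measure X} {x : X} {r a C : ℝ}
    (h : ∀ᶠ δ : ℝ in 𝓝[>] 0,
      ⨍ y in closedBall x r, Real.log (μ.real (closedBall y δ)) ∂μ ≤ a * Real.log δ + C) :
    (a : EReal) ≤ liminf (fun δ : ℝ => (entropyQuotient μ x r δ : EReal)) (𝓝[>] 0) := by
  rw [← (tendsto_add_div_log a C).liminf_eq]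
  refine liminf_le_liminf ?_
  filter_upwards [h, eventually_mem_Ioo_nhdsGT one_pos] with δ h1 h2
  have hneg : Real.log δ < 0 := Real.log_neg h2.1 h2.2
  rw [EReal.coe_le_coe_iff, entropyQuotient, le_div_iff_of_neg hneg, add_mul,
    div_mul_cancel₀ _ hneg.ne]
  exact h1

theorem limsup_entropyQuotient_le {μ : Measure X} {x : X} {r a C : ℝ}
    (h : ∀ᶠ δ : ℝ in 𝓝[>] 0,
      a * Real.log δ + C ≤ ⨍ y in closedBall x r, Real.log (μ.real (closedBall y δ)) ∂μ) :
    limsup (fun δ : ℝ => (entropyQuotient μ x r δ : EReal)) (𝓝[>] 0) ≤ (a : EReal) := by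
  rw [← (tendsto_add_div_log a C).limsup_eq]
  refine limsup_le_limsup ?_
  filter_upwards [h, eventually_mem_Ioo_nhdsGT one_pos] with δ h1 h2
  have hneg : Real.log δ < 0 := Real.log_neg h2.1 h2.2
  rw [EReal.coe_le_coe_iff, entropyQuotient, div_le_iff_of_neg hneg, add_mul,
    div_mul_cancel₀ _ hneg.ne]
  exact h1

theorem lowerEntropyDim_le_upperEntropyDim (μ : Measure X) (x : X) :
    lowerEntropyDim μ x ≤ upperEntropyDim μ x :=
  (liminf_le_liminf (Eventually.of_forall fun _ => liminf_le_limsup)).trans liminf_le_limsup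

theorem IsRadonMeasure.measure_closedBall_ne_top [BorelSpace X] {μ : Measure X}
    (hμ : IsRadonMeasure μ) (y : X) (s : ℝ) : μ (closedBall y s) ≠ ⊤ :=
  (hμ.finite_of_isBounded _ isBounded_closedBall).ne

theorem measureReal_closedBall_pos {μ : Measure X}
    (hfin : ∀ (y : X) (s : ℝ), μ (closedBall y s) ≠ ⊤) {x : X} (hx : x ∈ μ.support) {δ : ℝ}
    (hδ : 0 < δ) : 0 < μ.real (closedBall x δ) :=
  ENNReal.toReal_pos (measure_closedBall_ne_zero hx hδ) (hfin x δ)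

theorem measurable_measure_closedBall [BorelSpace X] (hX : IsDoublingSpace X) {μ : Measure X}
    (hμ : IsRadonMeasure μ) (δ : ℝ) : Measurable fun y : X => μ (closedBall y δ) := by
  have := hX.secondCountable
  have : IsLocallyFiniteMeasure μ := ⟨fun y =>
    ⟨closedBall y 1, closedBall_mem_nhds y one_pos, (hμ.measure_closedBall_ne_top y 1).lt_top⟩⟩
  have hs : MeasurableSet {p : X × X | dist p.2 p.1 ≤ δ} :=
    (isClosed_le (continuous_snd.dist continuous_fst) continuous_const).measurableSet
  exact measurable_measure_prodMk_left hs

theorem log_measureReal_le_of_dyadic {μ : Measure X}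
    {y : X} (hy : y ∈ μ.support) {s : ℝ} {k : ℕ}
    (h : ∀ n ≥ k, μ (closedBall y ((1 / 2) ^ n)) ≤ ENNReal.ofReal ((1 / 2) ^ n) ^ s)
    (hfin : ∀ (y : X) (s : ℝ), μ (closedBall y s) ≠ ⊤)
    {δ : ℝ} (h0 : 0 < δ) (hk : δ ≤ (1 / 2) ^ k) :
    Real.log (μ.real (closedBall y δ)) ≤ |s| * Real.log 2 + s * Real.log δ := by
  have hle := measure_closedBall_le_of_dyadic h h0 hk
  rw [← ENNReal.ofReal_ofNat 2, ENNReal.ofReal_rpow_of_pos two_pos, ENNReal.ofReal_rpow_of_pos h0,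
    ← ENNReal.ofReal_mul (by positivity)] at hle
  have hpos := measureReal_closedBall_pos hfin hy h0
  calc Real.log (μ.real (closedBall y δ)) ≤ Real.log (2 ^ |s| * δ ^ s) :=
        Real.log_le_log hpos (ENNReal.toReal_le_of_le_ofReal (by positivity) hle)
    _ = _ := by
        rw [Real.log_mul (by positivity) (by positivity), Real.log_rpow two_pos, Real.log_rpow h0]

theorem le_log_measureReal_of_dyadic {μ : Measure X} {y : X} {s : ℝ} {k : ℕ}
    (h : ∀ n ≥ k, ENNReal.ofReal ((1 / 2) ^ n) ^ s ≤ μ (closedBall y ((1 / 2) ^ n)))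
    (hfin : ∀ (y : X) (s : ℝ), μ (closedBall y s) ≠ ⊤)
    {δ : ℝ} (h0 : 0 < δ) (hk : δ ≤ (1 / 2) ^ k) :
    s * Real.log δ ≤ |s| * Real.log 2 + Real.log (μ.real (closedBall y δ)) := by
  have hle := le_measure_closedBall_of_dyadic h h0 hk
  rw [← ENNReal.ofReal_ofNat 2, ENNReal.ofReal_rpow_of_pos two_pos, ENNReal.ofReal_rpow_of_pos h0,
    ← ENNReal.ofReal_toReal (hfin y δ), ← ENNReal.ofReal_mul (by positivity),
    ENNReal.ofReal_le_ofReal_iff (by positivity)] at hle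
  have hδ : 0 < δ ^ s := by positivity
  have hpos : 0 < μ.real (closedBall y δ) :=
    pos_of_mul_pos_right (hδ.trans_le hle) (by positivity)
  rw [← Real.log_rpow h0, ← Real.log_rpow two_pos, ← Real.log_mul (by positivity) hpos.ne']
  exact Real.log_le_log hδ hle

/-- If `E` consists of points at which the measure decays uniformly at rate at least `s`, then the
mean in the entropy quotient is governed by `s` times the density of `E`. -/
theorem mul_density_le_liminf_entropyQuotient [BorelSpace X] (hX : IsDoublingSpace X)
    {μ : Measure X} (hμ : IsRadonMeasure μ) {E : Set X} (hE : MeasurableSet E) {s : ℝ} {k : ℕ}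
    (h : ∀ y ∈ E, ∀ n ≥ k, μ (closedBall y ((1 / 2) ^ n)) ≤ ENNReal.ofReal ((1 / 2) ^ n) ^ s)
    {x : X} (hx : x ∈ μ.support) {r : ℝ} (hr : 0 < r) :
    ((s * (μ (E ∩ closedBall x r) / μ (closedBall x r)).toReal : ℝ) : EReal) ≤
      liminf (fun δ : ℝ => (entropyQuotient μ x r δ : EReal)) (𝓝[>] 0) := by
  have := hX.secondCountable
  have hfin := hμ.measure_closedBall_ne_top
  -- the first summand bounds `log μ(B(y, δ))` off `E`, the second is the loss between dyadic radii
  set C : ℝ := |Real.log (μ.real (closedBall x (r + 1)))| + |s| * Real.log 2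
  have hl2 : 0 ≤ |s| * Real.log 2 := mul_nonneg (abs_nonneg s) (Real.log_nonneg one_le_two)
  refine le_liminf_entropyQuotient (C := C) ?_
  filter_upwards [eventually_mem_Ioo_nhdsGT (show (0 : ℝ) < (1 / 2) ^ k by positivity),
    eventually_mem_Ioo_nhdsGT one_pos] with δ hδ hδ1
  have hB : 0 < μ.real (closedBall x r) := measureReal_closedBall_pos hfin hx hr
  have hind : IntegrableOn (E.indicator fun _ => s * Real.log δ) (closedBall x r) μ :=
    (integrableOn_const (hfin x r)).indicator hE
  have hle : ∫ y in closedBall x r, Real.log (μ.real (closedBall y δ)) ∂μ ≤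
      ∫ y in closedBall x r, (E.indicator (fun _ => s * Real.log δ) y + C) ∂μ := by
    refine setIntegral_mono_on_ae (integrableOn_log_measure hX hμ x r hδ.1)
      (hind.add (integrableOn_const (hfin x r))) measurableSet_closedBall ?_
    filter_upwards [Measure.support_mem_ae (μ := μ)] with y hy hyx
    by_cases hyE : y ∈ E
    · rw [Set.indicator_of_mem hyE]
      have := log_measureReal_le_of_dyadic hy (h y hyE) hfin hδ.1 hδ.2.le
      have := abs_nonneg (Real.log (μ.real (closedBall x (r + 1))))
      simp only [C]
      linarith
    · rw [Set.indicator_of_notMem hyE, zero_add]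
      have h1 : μ.real (closedBall y δ) ≤ μ.real (closedBall x (r + 1)) := by
        refine measureReal_mono (closedBall_subset_closedBall' ?_) (hfin _ _)
        have := mem_closedBall.1 hyx
        linarith [hδ1.2]
      have h2 := Real.log_le_log (measureReal_closedBall_pos hfin hy hδ.1) h1
      have h3 := le_abs_self (Real.log (μ.real (closedBall x (r + 1))))
      simp only [C]
      linarith
  rw [integral_add hind (integrableOn_const (hfin x r)), setIntegral_indicator hE,
    setIntegral_const, setIntegral_const, smul_eq_mul, smul_eq_mul, Set.inter_comm] at hle
  rw [setAverage_eq, smul_eq_mul, ENNReal.toReal_div, inv_mul_le_iff₀ hB]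
  refine hle.trans_eq ?_
  simp only [Measure.real] at hB ⊢
  field_simp

/-- On a ball of radius `ρ ≤ δ / 2` centred at `z` the integrand is at most `1 / μ(B(z, ρ))`, so
each ball of the cover contributes at most `1`. -/
theorem lintegral_inv_measure_closedBall_le [OpensMeasurableSpace X] {μ : Measure X}
    {t : Finset X} {B : Set X} {δ ρ : ℝ}
    (hρ : 2 * ρ ≤ δ) (ht : B ⊆ ⋃ z ∈ t, closedBall z ρ) :
    ∫⁻ y in B, (μ (closedBall y δ))⁻¹ ∂μ ≤ t.card := by
  calc ∫⁻ y in B, (μ (closedBall y δ))⁻¹ ∂μ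
      ≤ ∫⁻ y in ⋃ z : t, closedBall (z : X) ρ, (μ (closedBall y δ))⁻¹ ∂μ :=
        lintegral_mono_set (by rwa [Set.iUnion_subtype])
    _ ≤ ∑' z : t, ∫⁻ y in closedBall (z : X) ρ, (μ (closedBall y δ))⁻¹ ∂μ :=
        lintegral_iUnion_le _ _
    _ ≤ ∑' _ : t, 1 := by
        refine ENNReal.tsum_le_tsum fun ⟨z, _⟩ => ?_
        calc ∫⁻ y in closedBall z ρ, (μ (closedBall y δ))⁻¹ ∂μ
            ≤ ∫⁻ y in closedBall z ρ, (μ (closedBall z ρ))⁻¹ ∂μ := by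
              refine setLIntegral_mono measurable_const fun y hy => ENNReal.inv_le_inv.2 ?_
              refine measure_mono (closedBall_subset_closedBall' ?_)
              have := mem_closedBall'.1 hy
              linarith
          _ = (μ (closedBall z ρ))⁻¹ * μ (closedBall z ρ) := setLIntegral_const _ _
          _ ≤ 1 := ENNReal.inv_mul_le_one _
    _ = t.card := by simp

/-- On a doubling space, `∫ 1 / μ(B(y, δ)) dμ(y)` over a ball grows at most polynomially in
`1 / δ`, with an exponent that depends on the doubling constant only. -/
theorem IsDoublingSpace.exists_integral_inv_measure_closedBall_le [BorelSpace X]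
    (hX : IsDoublingSpace X) : ∃ D : ℕ, ∀ {μ : Measure X}, IsRadonMeasure μ →
      ∀ (x : X) {r δ : ℝ}, 0 < δ → δ ≤ r →
        IntegrableOn (fun y => (μ.real (closedBall y δ))⁻¹) (closedBall x r) μ ∧
        ∫ y in closedBall x r, (μ.real (closedBall y δ))⁻¹ ∂μ ≤ (4 * r / δ) ^ D := by
  obtain ⟨N, -, hN⟩ := id hX
  -- any exponent `D` with `N ≤ 2 ^ D` works, for instance `D = N`
  refine ⟨N, fun {μ} hμ x r δ hδ hδr => ?_⟩
  have hr : 0 < r := hδ.trans_le hδr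
  obtain ⟨n, hn1, hn2⟩ := exists_nat_pow_near (x := 2 * r / δ) (y := 2)
    (by rw [le_div_iff₀ hδ]; linarith) one_lt_two
  obtain ⟨t, htN, ht⟩ := exists_finset_cover_pow hN (n + 1) x hr
  -- `r / 2 ^ (n + 1)` is at most `δ / 2`, and comparable to it
  have hρ : 2 * (r / 2 ^ (n + 1)) ≤ δ := by
    rw [div_lt_iff₀ hδ] at hn2
    rw [← mul_div_assoc, div_le_iff₀ (by positivity)]
    linarith
  have hcard : (t.card : ℝ) ≤ (4 * r / δ) ^ N := by
    calc (t.card : ℝ) ≤ (N : ℝ) ^ (n + 1) := by exact_mod_cast htN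
      _ ≤ ((2 : ℝ) ^ N) ^ (n + 1) := by
          gcongr
          exact_mod_cast Nat.lt_two_pow_self.le
      _ = (2 ^ n * 2) ^ N := by rw [← pow_succ, ← pow_mul, ← pow_mul, mul_comm]
      _ ≤ (2 * r / δ * 2) ^ N := by gcongr
      _ = (4 * r / δ) ^ N := by ring_nf
  have hlint := lintegral_inv_measure_closedBall_le (μ := μ) hρ ht
  have hmeas : Measurable fun y : X => (μ (closedBall y δ))⁻¹ :=
    (measurable_measure_closedBall hX hμ δ).inv
  have htop := ne_top_of_le_ne_top (ENNReal.natCast_ne_top _) hlint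
  have heq : ∀ y, (μ.real (closedBall y δ))⁻¹ = ((μ (closedBall y δ))⁻¹).toReal := fun y =>
    (ENNReal.toReal_inv _).symm
  simp only [heq]
  refine ⟨integrable_toReal_of_lintegral_ne_top hmeas.aemeasurable htop, ?_⟩
  rw [integral_toReal hmeas.aemeasurable (ae_lt_top hmeas htop)]
  exact (ENNReal.toReal_le_of_le_ofReal (Nat.cast_nonneg _) (by simpa using hlint)).trans hcard

/-- If `E` consists of points at which the measure decays uniformly at rate at most `s`, then the
mean in the entropy quotient is governed by `s` on `E`, and by a dimension bound `D` of the space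
off `E`. -/
theorem IsDoublingSpace.exists_limsup_entropyQuotient_le [BorelSpace X] (hX : IsDoublingSpace X) :
    ∃ D : ℝ, ∀ {μ : Measure X}, IsRadonMeasure μ → ∀ {E : Set X}, MeasurableSet E →
      ∀ {s : ℝ} {k : ℕ},
      (∀ y ∈ E, ∀ n ≥ k, ENNReal.ofReal ((1 / 2) ^ n) ^ s ≤ μ (closedBall y ((1 / 2) ^ n))) →
      ∀ {x : X}, x ∈ μ.support → ∀ {r : ℝ}, 0 < r →
      limsup (fun δ : ℝ => (entropyQuotient μ x r δ : EReal)) (𝓝[>] 0) ≤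
        (((s - D) * (μ (E ∩ closedBall x r) / μ (closedBall x r)).toReal + D : ℝ) : EReal) := by
  obtain ⟨D, hD⟩ := hX.exists_integral_inv_measure_closedBall_le
  refine ⟨D, fun {μ} hμ {E} hE {s k} h {x} hx {r} hr => ?_⟩
  have := hX.secondCountable
  have hfin := hμ.measure_closedBall_ne_top
  have hB : 0 < μ.real (closedBall x r) := measureReal_closedBall_pos hfin hx hr
  have hl2 : 0 ≤ |s| * Real.log 2 := mul_nonneg (abs_nonneg s) (Real.log_nonneg one_le_two)
  refine limsup_entropyQuotient_le
    (C := -(|s| * Real.log 2) - (4 * r) ^ D / μ.real (closedBall x r)) ?_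
  filter_upwards [eventually_mem_Ioo_nhdsGT (show (0 : ℝ) < (1 / 2) ^ k by positivity),
    eventually_mem_Ioo_nhdsGT hr] with δ hδ hδr
  obtain ⟨hint, hI⟩ := hD hμ x hδ.1 hδr.2.le
  have hconst : IntegrableOn (fun _ : X => D * Real.log δ - |s| * Real.log 2) (closedBall x r) μ :=
    integrableOn_const (hfin x r)
  have hind : IntegrableOn (E.indicator fun _ => (s - D) * Real.log δ) (closedBall x r) μ :=
    (integrableOn_const (hfin x r)).indicator hE
  have hle : ∫ y in closedBall x r, (E.indicator (fun _ => (s - D) * Real.log δ) y +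
        (D * Real.log δ - |s| * Real.log 2) - δ ^ D * (μ.real (closedBall y δ))⁻¹) ∂μ ≤
      ∫ y in closedBall x r, Real.log (μ.real (closedBall y δ)) ∂μ := by
    refine setIntegral_mono_on_ae ((hind.add hconst).sub (hint.const_mul _))
      (integrableOn_log_measure hX hμ x r hδ.1) measurableSet_closedBall ?_
    filter_upwards [Measure.support_mem_ae (μ := μ)] with y hy hyx
    have hpos : 0 < μ.real (closedBall y δ) :=
      measureReal_closedBall_pos hfin hy hδ.1
    have hδD : 0 < δ ^ D := pow_pos hδ.1 D
    have hq : 0 < δ ^ D * (μ.real (closedBall y δ))⁻¹ := by positivity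
    by_cases hyE : y ∈ E
    · rw [Set.indicator_of_mem hyE]
      have := le_log_measureReal_of_dyadic (h y hyE) hfin hδ.1 hδ.2.le
      linarith
    · rw [Set.indicator_of_notMem hyE, zero_add]
      -- the inequality `log u ≤ u - 1` at `u = δ ^ D / μ(B(y, δ))`
      have := Real.log_le_sub_one_of_pos hq
      rw [Real.log_mul hδD.ne' (inv_ne_zero hpos.ne'), Real.log_inv, Real.log_pow] at this
      linarith
  have hDint : δ ^ D * ∫ y in closedBall x r, (μ.real (closedBall y δ))⁻¹ ∂μ ≤ (4 * r) ^ D := by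
    have := mul_le_mul_of_nonneg_left hI (pow_pos hδ.1 D).le
    rwa [← mul_pow, mul_div_cancel₀ _ hδ.1.ne'] at this
  have hadd : IntegrableOn (fun y => E.indicator (fun _ => (s - D) * Real.log δ) y +
      (D * Real.log δ - |s| * Real.log 2)) (closedBall x r) μ := hind.add hconst
  rw [integral_sub hadd (hint.const_mul _), integral_add hind hconst, integral_const_mul,
    setIntegral_indicator hE, setIntegral_const, setIntegral_const, smul_eq_mul, smul_eq_mul,
    Set.inter_comm] at hle
  rw [setAverage_eq, smul_eq_mul, ENNReal.toReal_div, le_inv_mul_iff₀ hB]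
  refine le_trans ?_ (le_trans (sub_le_sub_left hDint _) hle)
  apply le_of_eq
  simp only [Measure.real] at hB ⊢
  field_simp
  ring

theorem measurableSet_forall_measure_closedBall_le [BorelSpace X] (hX : IsDoublingSpace X)
    {μ : Measure X} (hμ : IsRadonMeasure μ) (s : ℝ) (k : ℕ) : MeasurableSet
      {y : X | ∀ n ≥ k, μ (closedBall y ((1 / 2) ^ n)) ≤ ENNReal.ofReal ((1 / 2) ^ n) ^ s} := by
  simp only [Set.ofPred_forall]
  exact MeasurableSet.iInter fun n => MeasurableSet.iInter fun _ =>
    measurableSet_le (measurable_measure_closedBall hX hμ _) measurable_const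

theorem measurableSet_forall_le_measure_closedBall [BorelSpace X] (hX : IsDoublingSpace X)
    {μ : Measure X} (hμ : IsRadonMeasure μ) (s : ℝ) (k : ℕ) : MeasurableSet
      {y : X | ∀ n ≥ k, ENNReal.ofReal ((1 / 2) ^ n) ^ s ≤ μ (closedBall y ((1 / 2) ^ n))} := by
  simp only [Set.ofPred_forall]
  exact MeasurableSet.iInter fun n => MeasurableSet.iInter fun _ =>
    measurableSet_le measurable_const (measurable_measure_closedBall hX hμ _)

theorem ae_lowerLocalDim_le_lowerEntropyDim [BorelSpace X] (hX : IsDoublingSpace X)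
    {μ : Measure X} (hμ : IsRadonMeasure μ) (hd : HasDensityPointProperty μ) :
    ∀ᵐ x ∂μ, lowerLocalDim μ x ≤ lowerEntropyDim μ x := by
  have := hX.secondCountable
  have hae := ae_all_iff.2 fun s : ℚ => ae_all_iff.2 fun k : ℕ =>
    hd _ (measurableSet_forall_measure_closedBall_le hX hμ s k).nullMeasurableSet
  filter_upwards [hae, Measure.support_mem_ae (μ := μ)] with x hx hxs
  by_contra hlt
  obtain ⟨s, h1, h2⟩ := EReal.lt_iff_exists_rat_btwn.1 (not_le.1 hlt)
  obtain ⟨k, hk⟩ := eventually_atTop.1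
    (tendsto_half_pow_nhdsGT_zero.eventually (eventually_lt_rpow_of_lt_liminf h2))
  have hdens := hx s k fun n hn => (hk n hn).le
  have hlim := ((ENNReal.tendsto_toReal ENNReal.one_ne_top).comp hdens).const_mul (s : ℝ)
  rw [ENNReal.toReal_one, mul_one] at hlim
  refine h1.not_ge ?_
  rw [← ((continuous_coe_real_ereal.tendsto _).comp hlim).liminf_eq]
  refine liminf_le_liminf ?_
  filter_upwards [self_mem_nhdsWithin] with r hr
  exact mul_density_le_liminf_entropyQuotient hX hμ
    (measurableSet_forall_measure_closedBall_le hX hμ s k) (fun y hy => hy) hxs hr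

theorem ae_upperEntropyDim_le_upperLocalDim [BorelSpace X] (hX : IsDoublingSpace X)
    {μ : Measure X} (hμ : IsRadonMeasure μ) (hd : HasDensityPointProperty μ) :
    ∀ᵐ x ∂μ, upperEntropyDim μ x ≤ upperLocalDim μ x := by
  have := hX.secondCountable
  obtain ⟨D, hD⟩ := hX.exists_limsup_entropyQuotient_le
  have hae := ae_all_iff.2 fun s : ℚ => ae_all_iff.2 fun k : ℕ =>
    hd _ (measurableSet_forall_le_measure_closedBall hX hμ s k).nullMeasurableSet
  filter_upwards [hae, Measure.support_mem_ae (μ := μ)] with x hx hxs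
  by_contra hlt
  obtain ⟨s, h1, h2⟩ := EReal.lt_iff_exists_rat_btwn.1 (not_le.1 hlt)
  obtain ⟨k, hk⟩ := eventually_atTop.1
    (tendsto_half_pow_nhdsGT_zero.eventually (eventually_rpow_lt_of_limsup_lt h1))
  have hdens := hx s k fun n hn => (hk n hn).le
  have hlim := (((ENNReal.tendsto_toReal ENNReal.one_ne_top).comp hdens).const_mul
    ((s : ℝ) - D)).add_const D
  rw [ENNReal.toReal_one, mul_one, sub_add_cancel] at hlim
  refine h2.not_ge ?_
  rw [← ((continuous_coe_real_ereal.tendsto _).comp hlim).limsup_eq]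
  refine limsup_le_limsup ?_
  filter_upwards [self_mem_nhdsWithin] with r hr
  exact hD hμ (measurableSet_forall_le_measure_closedBall hX hμ s k) (fun y hy => hy) hxs hr

end LocalDim

theorem mainTheorem3 {X : Type*} [MetricSpace X] [MeasurableSpace X] [BorelSpace X]
    (hX : LocalDim.IsDoublingSpace X) (μ : Measure X) (hμ : LocalDim.IsRadonMeasure μ) :
    (∀ᵐ x ∂μ, ∃ a b : EReal,
      Tendsto (fun q : ℝ => LocalDim.localLqDim μ q x) (𝓝[>] 1) (𝓝 a) ∧
      Tendsto (fun q : ℝ => LocalDim.localLqDim μ q x) (𝓝[<] 1) (𝓝 b) ∧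
      a ≤ LocalDim.lowerLocalDim μ x ∧
      LocalDim.lowerLocalDim μ x ≤ LocalDim.upperLocalDim μ x ∧
      LocalDim.upperLocalDim μ x ≤ b) ∧
    (LocalDim.HasDensityPointProperty μ →
      ∀ᵐ x ∂μ,
        LocalDim.lowerLocalDim μ x ≤ LocalDim.lowerEntropyDim μ x ∧
        LocalDim.lowerEntropyDim μ x ≤ LocalDim.upperEntropyDim μ x ∧
        LocalDim.upperEntropyDim μ x ≤ LocalDim.upperLocalDim μ x) := by
  refine ⟨LocalDim.ae_exists_tendsto_localLqDim hX hμ.measure_closedBall_ne_top, fun hd => ?_⟩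
  filter_upwards [LocalDim.ae_lowerLocalDim_le_lowerEntropyDim hX hμ hd,
    LocalDim.ae_upperEntropyDim_le_upperLocalDim hX hμ hd] with x h1 h2
  exact ⟨h1, LocalDim.lowerEntropyDim_le_upperEntropyDim μ x, h2⟩
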